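/- For $n\ge 1$, a commutative ring $R$ with identity and $t\in R$, let $H^t_{2n+1}(R)$ be the group with underlying set $R^{n+1}\oplus R^n$ and multiplication \[ (a,b_1,\dots,b_n,c_1,\dots,c_n)(a',b'_1,\dots,b'_n,c'_1,\dots,c'_n)=\Bigl(a+a'+t\sum_{i=1}^n b'_ic_i,\ b_1+b'_1,\dots,b_n+b'_n,\ c_1+c'_1,\dots,c_n+c'_n\Bigr). \] Let $r\ge 0$ be an integer and let $t$ be a nonzero integer with $t\mid r$ (so $t$ is an arbitrary nonzero integer if $r=0$); we also write $t$ for its image in $\mathbb Z/r\mathbb Z$. For a group $G$, let $\mathrm H^2(G,\mathbb C^\times)$ denote the Schur multiplier of $G$, i.e. the second cohomology group of $G$ with coefficients in the trivial $G$-module $\mathbb C^\times$. Then there are the following isomorphisms of abstract groups. (i) For every $n>1$, \[ \mathrm H^2\bigl(H^t_{2n+1}(\mathbb Z/r\mathbb Z),\mathbb C^\times\bigr)\cong \begin{cases} (\mathbb Z/r\mathbb Z)^{2n^2-n-1}\times(\mathbb Z/t\mathbb Z)^{2n+1}, & \text{if } r\ge 1,\\ (\mathbb C^\times)^{2n^2-n-1}\times(\mathbb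 Z/t\mathbb Z)^{2n}, & \text{if } r=0. \end{cases} \] (ii) For $n=1$ and $r$ either odd or zero, \[ \mathrm H^2\bigl(H^t_{3}(\mathbb Z/r\mathbb Z),\mathbb C^\times\bigr)\cong \begin{cases} (\mathbb Z/r\mathbb Z)^{2}\times\mathbb Z/t\mathbb Z, & \text{if } r \text{ is odd},\\ (\mathbb C^\times)^{2}, & \text{if } r=0. \end{cases} \] -/

import Mathlib

/-- The underlying set `R ^ (n + 1) ⊕ R ^ n` of the `t`-variant of the Heisenberg group
`H^t_{2n+1}(R)`: its elements are `(a, b_1, …, b_n, c_1, …, c_n)`. -/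
@[ext]
structure HeisenbergVariant (n : ℕ) (R : Type*) (t : R) where
  a : R
  b : Fin n → R
  c : Fin n → R

namespace HeisenbergVariant

variable {n : ℕ} {R : Type*} [CommRing R] {t : R}

/-- `(a, b, c) (a', b', c') = (a + a' + t ∑ b'_i c_i, b + b', c + c')`. -/
instance : Mul (HeisenbergVariant n R t) :=
  ⟨fun x y => ⟨x.a + y.a + t * ∑ i, y.b i * x.c i, x.b + y.b, x.c + y.c⟩⟩

instance : One (HeisenbergVariant n R t) := ⟨⟨0, 0, 0⟩⟩

instance : Inv (HeisenbergVariant n R t) :=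
  ⟨fun x => ⟨-x.a + t * ∑ i, x.b i * x.c i, -x.b, -x.c⟩⟩

@[simp] theorem mul_a (x y : HeisenbergVariant n R t) :
    (x * y).a = x.a + y.a + t * ∑ i, y.b i * x.c i := rfl
@[simp] theorem mul_b (x y : HeisenbergVariant n R t) : (x * y).b = x.b + y.b := rfl
@[simp] theorem mul_c (x y : HeisenbergVariant n R t) : (x * y).c = x.c + y.c := rfl
@[simp] theorem one_a : (1 : HeisenbergVariant n R t).a = 0 := rfl
@[simp] theorem one_b : (1 : HeisenbergVariant n R t).b = 0 := rfl
@[simp] theorem one_c : (1 : HeisenbergVariant n R t).c = 0 := rfl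
@[simp] theorem inv_a (x : HeisenbergVariant n R t) :
    (x⁻¹).a = -x.a + t * ∑ i, x.b i * x.c i := rfl
@[simp] theorem inv_b (x : HeisenbergVariant n R t) : (x⁻¹).b = -x.b := rfl
@[simp] theorem inv_c (x : HeisenbergVariant n R t) : (x⁻¹).c = -x.c := rfl

instance : Group (HeisenbergVariant n R t) :=
  Group.ofLeftAxioms
    (by
      intro x y z
      ext i
      · simp [add_mul, mul_add, Finset.sum_add_distrib]
        ring
      · simp [add_assoc]
      · simp [add_assoc])
    (by intro x; ext i <;> simp)
    (by intro x; ext i <;> simp)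

end HeisenbergVariant

/-- The Schur multiplier `H²(G, ℂˣ)` of a group `G`, with `ℂˣ` (written additively) regarded as a
`ℤ`-module with trivial action of `G`. -/
noncomputable abbrev SchurMultiplier (G : Type) [Group G] : ModuleCat ℤ :=
  groupCohomology.H2 (Rep.trivial ℤ G (Additive ℂˣ))

/-! Write `R` for `ZMod r`. The group is the semidirect product of the abelian groups N = {(a, b,
0)} and C = {(0, 0, c)}, where c sends (a, b) to (a + t ∑ b_i c_i, b). The proof gives explicit
cocycles, decides which of them are coboundaries, and shows that they represent every class.

The parameters are characters of `R`: p and q pair the b's and the c's alternatingly, s pairs c_i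
with b_j, and μ, ν pair the centre with the b's and the c's. For n > 1 the cocycle condition forces
μ and ν to kill tR. For n = 1 there is no such condition, but the cocycle needs a correction by a
function η with η(x + y) = η x + η y + xy; this is why r is odd or zero there.

A coboundary is symmetric on commuting pairs, which forces p, q, μ, ν and the off-diagonal s to
vanish. The diagonal of s survives only modulo the coboundary of a function of a, that is, modulo a
common character x ↦ m(tx) (`isTwoCoboundary_explicitCocycle_iff`). Conversely, after removing its
commutator pairings on N and C, a cocycle is symmetric there, hence splits because ℂˣ is divisible.
What remains lives on C × N and is given by s and ν (`exists_isTwoCoboundary_sub_explicitCocycle`).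

Counting: p, q, off-diagonal s and differences of its diagonal give 2n(n-1) + (n-1) = 2n² - n - 1
characters of `R`; one diagonal entry gives the cokernel of t on characters; μ and ν give 2n central
characters. -/

/-! ### Two-cocycles with trivial coefficients and their commutator pairing. -/

section TrivialCoefficients

variable {G K : Type*} [AddCommGroup K]

/-- Inhomogeneous 2-cocycles with values in a trivial module. -/
def IsTwoCocycle [Mul G] (f : G → G → K) : Prop :=
  ∀ g h k, f (g * h) k + f g h = f h k + f g (h * k)

/-- Inhomogeneous 2-coboundaries with values in a trivial module. -/
def IsTwoCoboundary [Mul G] (f : G → G → K) : Prop :=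
  ∃ ψ : G → K, ∀ g h, f g h = ψ g + ψ h - ψ (g * h)

theorem IsTwoCoboundary.isTwoCocycle [Semigroup G] {f : G → G → K} (hf : IsTwoCoboundary f) :
    IsTwoCocycle f := by
  obtain ⟨ψ, hψ⟩ := hf
  intro g h k
  simp only [hψ, mul_assoc]
  abel

theorem IsTwoCocycle.add [Mul G] {f f' : G → G → K} (hf : IsTwoCocycle f)
    (hf' : IsTwoCocycle f') : IsTwoCocycle (f + f') := fun g h k => by
  have := congrArg₂ (· + ·) (hf g h k) (hf' g h k)
  simp only [Pi.add_apply] at this ⊢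
  rw [add_add_add_comm, this, add_add_add_comm]

theorem IsTwoCocycle.neg [Mul G] {f : G → G → K} (hf : IsTwoCocycle f) :
    IsTwoCocycle (-f) := fun g h k => by
  have := congrArg (- ·) (hf g h k)
  simpa only [neg_add, Pi.neg_apply] using this

theorem IsTwoCocycle.sub [Mul G] {f f' : G → G → K} (hf : IsTwoCocycle f)
    (hf' : IsTwoCocycle f') : IsTwoCocycle (f - f') := by
  rw [sub_eq_add_neg]; exact hf.add hf'.neg

theorem IsTwoCocycle.sum [Mul G] {ι : Type*} {s : Finset ι} {f : ι → G → G → K}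
    (hf : ∀ i ∈ s, IsTwoCocycle (f i)) : IsTwoCocycle (fun g h => ∑ i ∈ s, f i g h) :=
  fun g h k => by
    simp only [← Finset.sum_add_distrib]
    exact Finset.sum_congr rfl fun i hi => hf i hi g h k

/-- This is the obstruction that shows explicit cocycles to be nontrivial. -/
theorem IsTwoCoboundary.eq_of_commute [Mul G] {f : G → G → K} (hf : IsTwoCoboundary f)
    {g h : G} (hgh : g * h = h * g) : f g h = f h g := by
  obtain ⟨ψ, hψ⟩ := hf
  rw [hψ, hψ, hgh, add_comm (ψ g)]

/-- The commutator pairing of a cocycle is additive in its first argument on commuting elements. -/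
theorem IsTwoCocycle.commutator_mul_left [Semigroup G] {f : G → G → K} (hf : IsTwoCocycle f)
    {x y z : G} (hxz : x * z = z * x) (hyz : y * z = z * y) :
    f (x * y) z - f z (x * y) = (f x z - f z x) + (f y z - f z y) := by
  have h1 := hf x y z
  have h2 := hf x z y
  have h3 := hf z x y
  rw [hyz] at h1
  rw [hxz] at h2
  have e1 : f (x * y) z = f y z + f x (z * y) - f x y := eq_sub_of_add_eq h1
  have e2 : f x (z * y) = f (z * x) y + f x z - f z y := by rw [h2]; abel
  have e3 : f z (x * y) = f (z * x) y + f z x - f x y := by rw [h3]; abel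
  rw [e1, e2, e3]
  abel

/-- The commutator pairing of a cocycle is additive in its second argument on commuting elements. -/
theorem IsTwoCocycle.commutator_mul_right [Semigroup G] {f : G → G → K} (hf : IsTwoCocycle f)
    {x y z : G} (hxz : x * z = z * x) (hyz : y * z = z * y) :
    f z (x * y) - f (x * y) z = (f z x - f x z) + (f z y - f y z) := by
  have := congrArg (- ·) (hf.commutator_mul_left hxz hyz)
  simpa only [neg_sub, neg_add] using this

/-- The commutator pairing of a cocycle is invariant under conjugation. -/
theorem IsTwoCocycle.commutator_conj [Semigroup G] {f : G → G → K} (hf : IsTwoCocycle f)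
    {g x y x' y' : G} (hxy : x * y = y * x) (hx : g * x = x' * g) (hy : g * y = y' * g)
    (hxy' : x' * y' = y' * x') :
    f x' y' - f y' x' = f x y - f y x := by
  have a1 := hf g x y
  have a2 := hf x' g y
  have a3 := hf x' y' g
  have b1 := hf g y x
  have b2 := hf y' g x
  have b3 := hf y' x' g
  rw [hx] at a1
  rw [hy] at a2
  rw [hy, ← hxy] at b1
  rw [hx] at b2
  rw [← hxy'] at b3
  have e1 : f x y = f (x' * g) y + f g x - f g (x * y) := by rw [a1]; abel
  have e2 : f (x' * g) y = f g y + f x' (y' * g) - f x' g := by rw [← a2]; abel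
  have e3 : f x' (y' * g) = f (x' * y') g + f x' y' - f y' g := by rw [a3]; abel
  have d1 : f y x = f (y' * g) x + f g y - f g (x * y) := by rw [b1]; abel
  have d2 : f (y' * g) x = f g x + f y' (x' * g) - f y' g := by rw [← b2]; abel
  have d3 : f y' (x' * g) = f (x' * y') g + f y' x' - f x' g := by rw [b3]; abel
  rw [e1, e2, e3, d1, d2, d3]
  abel

end TrivialCoefficients

/-! ### Comparison with group cohomology. -/

theorem isTwoCocycle_iff_mem_cocycles₂ {G : Type} [Group G] (f : G → G → Additive ℂˣ) :
    IsTwoCocycle f ↔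
      (fun p : G × G => f p.1 p.2) ∈
        groupCohomology.cocycles₂ (Rep.trivial ℤ G (Additive ℂˣ)) := by
  rw [groupCohomology.mem_cocycles₂_iff]
  rfl

theorem isTwoCoboundary_iff_mem_coboundaries₂ {G : Type} [Group G] (f : G → G → Additive ℂˣ) :
    IsTwoCoboundary f ↔
      (fun p : G × G => f p.1 p.2) ∈
        groupCohomology.coboundaries₂ (Rep.trivial ℤ G (Additive ℂˣ)) := by
  refine exists_congr fun ψ => ?_
  rw [funext_iff, Prod.forall]
  refine forall_congr' fun g => forall_congr' fun h => ?_
  change f g h = _ ↔ ψ h - ψ (g * h) + ψ g = f g h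
  rw [eq_comm, add_comm (ψ g), add_sub_right_comm]

/-- A surjection onto `T` with the same kernel as a surjective parametrization of the second
cohomology classes by explicit cocycles identifies the Schur multiplier with `T`. -/
theorem nonempty_schurMultiplier_addEquiv {G : Type} [Group G] {D T : Type*} [AddCommGroup D]
    [AddCommGroup T] (F : D →+ (G → G → Additive ℂˣ)) (hF : ∀ d, IsTwoCocycle (F d))
    (π : D →+ T) (hπ : Function.Surjective π) (hker : ∀ d, IsTwoCoboundary (F d) ↔ π d = 0)
    (hsurj : ∀ f : G → G → Additive ℂˣ, IsTwoCocycle f → ∃ d, IsTwoCoboundary (f - F d)) :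
    Nonempty (SchurMultiplier G ≃+ T) := by
  let A := Rep.trivial ℤ G (Additive ℂˣ)
  let Z : D →+ groupCohomology.cocycles₂ A :=
    { toFun := fun d => ⟨fun p => F d p.1 p.2, (isTwoCocycle_iff_mem_cocycles₂ _).1 (hF d)⟩
      map_zero' := by
        apply Subtype.ext
        funext p
        change F 0 p.1 p.2 = 0
        rw [map_zero]
        rfl
      map_add' := fun d e => by
        apply Subtype.ext
        funext p
        change F (d + e) p.1 p.2 = F d p.1 p.2 + F e p.1 p.2
        rw [map_add]
        rfl }
  let Φ : D →+ SchurMultiplier G := ((groupCohomology.H2π A).hom.toAddMonoidHom).comp Z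
  have hΦ0 : ∀ d, Φ d = 0 ↔ π d = 0 := fun d => by
    rw [← hker, isTwoCoboundary_iff_mem_coboundaries₂]
    exact groupCohomology.H2π_eq_zero_iff (Z d)
  have hΦs : Function.Surjective Φ := by
    intro x
    induction x using groupCohomology.H2_induction_on with
    | h x =>
      obtain ⟨d, hd⟩ := hsurj (fun g h => x.1 (g, h))
        ((isTwoCocycle_iff_mem_cocycles₂ _).2 x.2)
      refine ⟨d, ?_⟩
      refine ((groupCohomology.H2π_eq_iff x (Z d)).2 ?_).symm
      exact (isTwoCoboundary_iff_mem_coboundaries₂ _).1 hd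
  have hk : Φ.ker = π.ker := by
    ext d
    exact hΦ0 d
  exact ⟨(QuotientAddGroup.quotientKerEquivOfSurjective Φ hΦs).symm.trans
    ((QuotientAddGroup.quotientAddEquivOfEq hk).trans
      (QuotientAddGroup.quotientKerEquivOfSurjective π hπ))⟩

/-! ### Splitting of abelian extensions by divisible groups. -/

section Symmetric

variable {A K : Type*} [AddCommGroup A] [AddCommGroup K]

/-- The abelian extension of `A` by `K` attached to a symmetric cocycle. -/
@[ext]
structure SymmetricExtension (f : A → A → K) where
  fst : A
  snd : K

namespace SymmetricExtension

variable {f : A → A → K}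

instance : Add (SymmetricExtension f) :=
  ⟨fun p q => ⟨p.fst + q.fst, p.snd + q.snd + f p.fst q.fst⟩⟩

/-- The cocycle is not assumed normalized, so the identity has second component -f(0, 0). -/
instance : Zero (SymmetricExtension f) := ⟨⟨0, -f 0 0⟩⟩

instance : Neg (SymmetricExtension f) := ⟨fun p => ⟨-p.fst, -p.snd - f (-p.fst) p.fst - f 0 0⟩⟩

/-- The group structure on the extension attached to a symmetric cocycle. -/
abbrev addCommGroup (hf : ∀ x y z, f (x + y) z + f x y = f y z + f x (y + z))
    (hs : ∀ x y, f x y = f y x) : AddCommGroup (SymmetricExtension f) :=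
  { AddGroup.ofLeftAxioms
      (fun p q s => by
        apply SymmetricExtension.ext
        · exact add_assoc _ _ _
        · change p.snd + q.snd + f p.fst q.fst + s.snd + f (p.fst + q.fst) s.fst =
            p.snd + (q.snd + s.snd + f q.fst s.fst) + f p.fst (q.fst + s.fst)
          linear_combination (norm := abel) hf p.fst q.fst s.fst)
      (fun p => by
        apply SymmetricExtension.ext
        · exact zero_add _
        · have := hf 0 0 p.fst
          simp only [zero_add] at this
          change -f 0 0 + p.snd + f 0 p.fst = p.snd
          linear_combination (norm := abel) -this)
      (fun p => by
        apply SymmetricExtension.ext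
        · exact neg_add_cancel _
        · change -p.snd - f (-p.fst) p.fst - f 0 0 + p.snd + f (-p.fst) p.fst = -f 0 0
          abel) with
    add_comm := fun p q => by
      apply SymmetricExtension.ext
      · exact add_comm _ _
      · change p.snd + q.snd + f p.fst q.fst = q.snd + p.snd + f q.fst p.fst
        rw [hs, add_comm p.snd] }

end SymmetricExtension

/-- Abelian extensions by a divisible group split. -/
theorem exists_eq_add_sub_of_symmetric [DivisibleBy K ℤ] {f : A → A → K}
    (hf : ∀ x y z, f (x + y) z + f x y = f y z + f x (y + z)) (hs : ∀ x y, f x y = f y x) :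
    ∃ ψ : A → K, ∀ x y, f x y = ψ x + ψ y - ψ (x + y) := by
  let _ := SymmetricExtension.addCommGroup hf hs
  let ι : K →+ SymmetricExtension f :=
    AddMonoidHom.mk' (fun k => ⟨0, k - f 0 0⟩) fun k l => by
      apply SymmetricExtension.ext
      · exact (add_zero 0).symm
      · change k + l - f 0 0 = k - f 0 0 + (l - f 0 0) + f 0 0
        abel
  have hι : Function.Injective ι := fun k l h =>
    sub_left_injective (congrArg SymmetricExtension.snd h)
  -- Divisible groups are injective, so the inclusion of `K` has a retraction; its values on the
  -- set-theoretic section x ↦ (x, 0) give ψ.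
  obtain ⟨ρ, hρ⟩ :=
    (Module.Baer.of_divisible K).extension_property_addMonoidHom ι hι (AddMonoidHom.id K)
  have hρ' : ∀ k, ρ ⟨0, k⟩ = k + f 0 0 := fun k => by
    have := DFunLike.congr_fun hρ (k + f 0 0)
    change ρ ⟨0, k + f 0 0 - f 0 0⟩ = k + f 0 0 at this
    rwa [add_sub_cancel_right] at this
  have h0 : ∀ x, f 0 x = f 0 0 := fun x => by
    have := hf 0 0 x
    simp only [zero_add] at this
    exact (add_left_cancel this).symm
  refine ⟨fun x => ρ ⟨x, 0⟩, fun x y => ?_⟩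
  have e1 : (⟨x, 0⟩ : SymmetricExtension f) + ⟨y, 0⟩ =
      ⟨x + y, 0⟩ + ⟨0, f x y - f 0 0⟩ := by
    apply SymmetricExtension.ext
    · change x + y = x + y + 0
      rw [add_zero]
    · change 0 + 0 + f x y = 0 + (f x y - f 0 0) + f (x + y) 0
      rw [hs (x + y) 0, h0 (x + y)]
      abel
  have e2 := congrArg ρ e1
  rw [map_add, map_add, hρ', sub_add_cancel] at e2
  exact eq_sub_of_add_eq' e2.symm

end Symmetric

/-! ### Additive and biadditive maps checked on generators. -/

section Biadditive

variable {A B K : Type*} [AddCommGroup A] [AddCommGroup B] [AddCommGroup K]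

theorem eq_zero_of_additive_of_closure_eq_top {f : A → K} (hf : ∀ x y, f (x + y) = f x + f y)
    {S : Set A} (hS : AddSubgroup.closure S = ⊤) (h : ∀ x ∈ S, f x = 0) (x : A) : f x = 0 :=
  DFunLike.congr_fun (AddMonoidHom.eq_of_eqOn_dense hS (f := AddMonoidHom.mk' f hf) (g := 0) h) x

theorem eq_zero_of_biadditive_of_closure_eq_top {f : A → B → K}
    (hl : ∀ x y z, f (x + y) z = f x z + f y z) (hr : ∀ x y z, f x (y + z) = f x y + f x z)
    {S : Set A} (hS : AddSubgroup.closure S = ⊤) {S' : Set B} (hS' : AddSubgroup.closure S' = ⊤)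
    (h : ∀ x ∈ S, ∀ y ∈ S', f x y = 0) (x : A) (y : B) : f x y = 0 :=
  eq_zero_of_additive_of_closure_eq_top (f := fun x => f x y) (fun _ _ => hl _ _ _) hS
    (fun x hx => eq_zero_of_additive_of_closure_eq_top (hr x) hS' (h x hx) y) x

theorem Pi.closure_range_single_one {R : Type*} [Ring R]
    (hR : Function.Surjective (Int.cast : ℤ → R)) (n : ℕ) :
    AddSubgroup.closure (Set.range fun i : Fin n => (Pi.single i 1 : Fin n → R)) = ⊤ := by
  rw [AddSubgroup.eq_top_iff']
  intro x
  rw [← Finset.univ_sum_single x]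
  refine sum_mem fun i _ => ?_
  obtain ⟨k, hk⟩ := hR (x i)
  rw [← hk, ← zsmul_one, Pi.single_smul]
  exact zsmul_mem (AddSubgroup.subset_closure (Set.mem_range_self i)) k

theorem Pi.closure_iUnion_range_single {R : Type*} [AddCommGroup R] (n : ℕ) :
    AddSubgroup.closure (⋃ i : Fin n, Set.range fun x => (Pi.single i x : Fin n → R)) = ⊤ := by
  rw [AddSubgroup.eq_top_iff']
  intro x
  rw [← Finset.univ_sum_single x]
  exact sum_mem fun i _ => AddSubgroup.subset_closure (Set.mem_iUnion.2 ⟨i, _, rfl⟩)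

theorem Prod.closure_range_single_one {R : Type*} [Ring R]
    (hR : Function.Surjective (Int.cast : ℤ → R)) (n : ℕ) :
    AddSubgroup.closure (insert ((1 : R), (0 : Fin n → R))
      (Set.range fun i : Fin n => ((0 : R), (Pi.single i 1 : Fin n → R)))) = ⊤ := by
  rw [AddSubgroup.eq_top_iff']
  rintro ⟨a, b⟩
  rw [← Prod.fst_add_snd (a, b)]
  refine add_mem ?_ ?_
  · obtain ⟨k, rfl⟩ := hR a
    have : (((k : R), (0 : Fin n → R))) = k • ((1 : R), (0 : Fin n → R)) := by simp
    rw [this]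
    exact zsmul_mem (AddSubgroup.subset_closure (Set.mem_insert _ _)) k
  · have hb : b ∈ (AddSubgroup.closure (insert ((1 : R), (0 : Fin n → R))
        (Set.range fun i : Fin n => ((0 : R), (Pi.single i 1 : Fin n → R))))).comap
          (AddMonoidHom.inr R (Fin n → R)) := by
      have h := Pi.closure_range_single_one hR n
      refine (AddSubgroup.closure_le _).2 ?_ (h ▸ AddSubgroup.mem_top b)
      rintro _ ⟨i, rfl⟩
      exact AddSubgroup.subset_closure (Set.mem_insert_of_mem _ ⟨i, rfl⟩)
    exact hb

end Biadditive

/-! ### Explicit cocycles on the Heisenberg group. -/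

namespace HeisenbergVariant

section Cocycles

variable (n : ℕ) {R : Type*} [CommRing R] (τ : R) (K : Type*) [AddCommGroup K]

/-- The characters of `R` that can occur as commutators with the centre in a central extension of
`HeisenbergVariant n R τ`. -/
def centralCharacters : AddSubgroup (R →+ K) where
  carrier := {m | 1 < n → ∀ x, m (τ * x) = 0}
  zero_mem' := fun _ _ => rfl
  add_mem' := fun {m m'} hm hm' hn x => by simp [hm hn, hm' hn]
  neg_mem' := fun {m} hm hn x => by simp [hm hn]

/-- Parameters for the explicit cocycles on `HeisenbergVariant n R τ`. -/
abbrev CocycleData : Type _ :=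
  ({u : Fin n × Fin n // u.1 < u.2} → R →+ K) × ({u : Fin n × Fin n // u.1 < u.2} → R →+ K) ×
    (Fin n → Fin n → R →+ K) × (Fin n → centralCharacters n τ K) ×
      (Fin n → centralCharacters n τ K)

variable {n K}

/-- The explicit cocycle with given parameters; `η` is an auxiliary function, only relevant for
`n = 1`, where it has to be a quadratic function with polarization `x * y`. -/
def explicitCocycle (η : R → R) :
    CocycleData n τ K →+
      (HeisenbergVariant n R τ → HeisenbergVariant n R τ → K) :=
  AddMonoidHom.mk' (fun d g h =>
    (∑ u, d.1 u (g.b u.1.1 * h.b u.1.2)) + (∑ u, d.2.1 u (g.c u.1.1 * h.c u.1.2)) +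
      (∑ i, ∑ j, d.2.2.1 i j (g.c i * h.b j)) +
      (∑ j, (d.2.2.2.1 j).1 (g.a * h.b j + τ * (g.c j * η (h.b j)))) +
      (∑ j, (d.2.2.2.2 j).1 (h.a * g.c j + τ * (h.b j * η (g.c j))))) fun d d' => by
    funext g h
    simp only [Prod.fst_add, Prod.snd_add, Pi.add_apply, AddMonoidHom.add_apply,
      AddSubgroup.coe_add, Finset.sum_add_distrib]
    abel

variable {τ}

theorem explicitCocycle_apply (η : R → R) (d : CocycleData n τ K)
    (g h : HeisenbergVariant n R τ) :
    explicitCocycle τ η d g h =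
      (∑ u, d.1 u (g.b u.1.1 * h.b u.1.2)) + (∑ u, d.2.1 u (g.c u.1.1 * h.c u.1.2)) +
      (∑ i, ∑ j, d.2.2.1 i j (g.c i * h.b j)) +
      (∑ j, (d.2.2.2.1 j).1 (g.a * h.b j + τ * (g.c j * η (h.b j)))) +
      (∑ j, (d.2.2.2.2 j).1 (h.a * g.c j + τ * (h.b j * η (g.c j)))) := rfl

theorem isTwoCocycle_mul (m : R →+ K) {G : Type*} [Mul G] {φ ψ : G → R}
    (hφ : ∀ g h, φ (g * h) = φ g + φ h) (hψ : ∀ g h, ψ (g * h) = ψ g + ψ h) :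
    IsTwoCocycle fun g h => m (φ g * ψ h) := fun g h k => by
  simp only [← map_add, hφ, hψ]
  congr 1
  ring

/-- For n > 1 the character kills all of τR; for n = 1 the argument itself is zero, as the
polarization of η cancels the product. -/
theorem centralCharacters_apply_eq_zero {η : R → R}
    (hη : n = 1 → ∀ x y, η (x + y) = η x + η y + x * y) {m : R →+ K}
    (hm : m ∈ centralCharacters n τ K) (x y : Fin n → R) (z : R) (j : Fin n) :
    m (τ * ((∑ i, x i * y i) * z + y j * (η z + η (x j) - η (x j + z)))) = 0 := by
  rcases Nat.lt_or_ge 1 n with hn | hn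
  · exact hm hn _
  · obtain rfl : n = 1 := le_antisymm hn (Fin.pos j)
    obtain rfl := Subsingleton.elim 0 j
    rw [Fin.sum_univ_one, hη rfl, ← map_zero m]
    congr 1
    ring

/-- The bilinear terms are cocycles because b and c are homomorphisms. The coordinate a is not one,
and the resulting defect of the μ and ν terms is exactly what `centralCharacters_apply_eq_zero`
kills. -/
theorem isTwoCocycle_explicitCocycle {η : R → R}
    (hη : n = 1 → ∀ x y, η (x + y) = η x + η y + x * y) (d : CocycleData n τ K) :
    IsTwoCocycle (explicitCocycle τ η d) := by
  obtain ⟨p, q, s, μ, ν⟩ := d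
  refine ((((IsTwoCocycle.sum fun u _ => ?_).add (IsTwoCocycle.sum fun u _ => ?_)).add
    (IsTwoCocycle.sum fun i _ => IsTwoCocycle.sum fun j _ => ?_)).add
      (IsTwoCocycle.sum fun j _ => ?_)).add (IsTwoCocycle.sum fun j _ => ?_)
  · exact isTwoCocycle_mul _ (fun _ _ => rfl) fun _ _ => rfl
  · exact isTwoCocycle_mul _ (fun _ _ => rfl) fun _ _ => rfl
  · exact isTwoCocycle_mul _ (fun _ _ => rfl) fun _ _ => rfl
  · intro g h k
    have := centralCharacters_apply_eq_zero hη (μ j).2 h.b g.c (k.b j) j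
    rw [← map_add, ← map_add, ← sub_eq_zero, ← map_sub, ← this]
    congr 1
    simp only [mul_a, mul_b, mul_c, Pi.add_apply]
    ring
  · intro g h k
    have := centralCharacters_apply_eq_zero hη (ν j).2 h.c k.b (g.c j) j
    rw [← map_add, ← map_add, eq_comm, ← sub_eq_zero, ← map_sub, ← this]
    congr 1
    simp only [mul_a, mul_b, mul_c, Pi.add_apply, mul_comm (k.b _), add_comm (g.c j)]
    ring

end Cocycles

end HeisenbergVariant

/-! ### Which explicit cocycles are coboundaries. -/

namespace HeisenbergVariant

section Kernel

variable {n : ℕ} {R : Type*} [CommRing R] {τ : R} {K : Type*} [AddCommGroup K]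

theorem sum_lt_single_mul_single (p : {u : Fin n × Fin n // u.1 < u.2} → R →+ K) (i j : Fin n)
    (x y : R) :
    (∑ u, p u ((Pi.single i x : Fin n → R) u.1.1 * (Pi.single j y : Fin n → R) u.1.2)) =
      if h : i < j then p ⟨(i, j), h⟩ (x * y) else 0 := by
  have hne : ∀ u : {u : Fin n × Fin n // u.1 < u.2}, u.1 ≠ (i, j) →
      p u ((Pi.single i x : Fin n → R) u.1.1 * (Pi.single j y : Fin n → R) u.1.2) = 0 := by
    intro u hu
    by_cases h1 : u.1.1 = i
    · have h2 : u.1.2 ≠ j := fun h2 => hu (Prod.ext h1 h2)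
      rw [Pi.single_eq_of_ne h2, mul_zero, map_zero]
    · rw [Pi.single_eq_of_ne h1, zero_mul, map_zero]
  split_ifs with h
  · rw [Finset.sum_eq_single ⟨(i, j), h⟩ (fun u _ hu => hne u fun e => hu (Subtype.ext e))
      (fun hu => absurd (Finset.mem_univ _) hu)]
    simp
  · exact Finset.sum_eq_zero fun u _ => hne u fun e => h (by have := u.2; rwa [e] at this)

theorem sum_sum_single_mul_single (s : Fin n → Fin n → R →+ K) (i j : Fin n) (x y : R) :
    (∑ k, ∑ l, s k l ((Pi.single i x : Fin n → R) k * (Pi.single j y : Fin n → R) l)) =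
      s i j (x * y) := by
  rw [Finset.sum_eq_single i, Finset.sum_eq_single j]
  · simp
  · intro l _ hl
    rw [Pi.single_eq_of_ne hl, mul_zero, map_zero]
  · exact fun h => absurd (Finset.mem_univ _) h
  · intro k _ hk
    exact Finset.sum_eq_zero fun l _ => by rw [Pi.single_eq_of_ne hk, zero_mul, map_zero]
  · exact fun h => absurd (Finset.mem_univ _) h

theorem sum_apply_mul_single (φ : Fin n → R →+ K) (a y : R) (i : Fin n) :
    (∑ j, φ j (a * (Pi.single i y : Fin n → R) j)) = φ i (a * y) := by
  rw [Finset.sum_eq_single i, Pi.single_eq_same]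
  · intro j _ hj
    rw [Pi.single_eq_of_ne hj, mul_zero, map_zero]
  · exact fun h => absurd (Finset.mem_univ _) h

theorem explicitCocycle_normal {η : R → R} (hη0 : η 0 = 0) (d : CocycleData n τ K)
    (a a' : R) (b b' : Fin n → R) :
    explicitCocycle τ η d ⟨a, b, 0⟩ ⟨a', b', 0⟩ =
      (∑ u, d.1 u (b u.1.1 * b' u.1.2)) + ∑ j, (d.2.2.2.1 j).1 (a * b' j) := by
  simp [explicitCocycle_apply, hη0]

theorem explicitCocycle_complement {η : R → R} (hη0 : η 0 = 0) (d : CocycleData n τ K)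
    (a : R) (c c' : Fin n → R) :
    explicitCocycle τ η d ⟨a, 0, c⟩ ⟨0, 0, c'⟩ =
      ∑ u, d.2.1 u (c u.1.1 * c' u.1.2) := by
  simp [explicitCocycle_apply, hη0]

theorem explicitCocycle_zero_zero_zero (η : R → R) (s : Fin n → Fin n → R →+ K)
    (ν : Fin n → centralCharacters n τ K) (g h : HeisenbergVariant n R τ) :
    explicitCocycle τ η (0, 0, s, 0, ν) g h =
      (∑ i, ∑ j, s i j (g.c i * h.b j)) +
        ∑ j, (ν j).1 (h.a * g.c j + τ * (h.b j * η (g.c j))) := by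
  simp [explicitCocycle_apply]

/-- Commuting pairs of coordinate elements read off every parameter except the diagonal of s. The
pair b_i, c_i commutes only up to the centre, so there s is determined by the restriction of ψ to
the centre. -/
theorem isTwoCoboundary_explicitCocycle_iff {η : R → R} (hη0 : η 0 = 0) (d : CocycleData n τ K) :
    IsTwoCoboundary (explicitCocycle τ η d) ↔
      d.1 = 0 ∧ d.2.1 = 0 ∧ d.2.2.2.1 = 0 ∧ d.2.2.2.2 = 0 ∧
        (∀ i j, i ≠ j → d.2.2.1 i j = 0) ∧ ∃ m : R →+ K, ∀ i x, d.2.2.1 i i x = m (τ * x) := by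
  constructor
  · intro hF
    have hp : d.1 = 0 := by
      funext ⟨⟨i, j⟩, hij⟩
      ext x
      have hij' : i < j := hij
      have := hF.eq_of_commute (g := ⟨0, Pi.single i x, 0⟩) (h := ⟨0, Pi.single j 1, 0⟩)
        (by ext k <;> simp [add_comm])
      simpa [explicitCocycle_normal hη0, sum_lt_single_mul_single, hij', hij'.not_gt] using this
    have hq : d.2.1 = 0 := by
      funext ⟨⟨i, j⟩, hij⟩
      ext x
      have hij' : i < j := hij
      have := hF.eq_of_commute (g := ⟨0, 0, Pi.single i x⟩) (h := ⟨0, 0, Pi.single j 1⟩)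
        (by ext k <;> simp [add_comm])
      simpa [explicitCocycle_complement hη0, sum_lt_single_mul_single, hij', hij'.not_gt] using this
    have hμ : d.2.2.2.1 = 0 := by
      funext j
      ext x
      have := hF.eq_of_commute (g := ⟨x, 0, 0⟩) (h := ⟨0, Pi.single j 1, 0⟩)
        (by ext k <;> simp)
      rw [explicitCocycle_normal hη0, explicitCocycle_normal hη0] at this
      simpa [Pi.single_apply, apply_ite] using this
    have hν : d.2.2.2.2 = 0 := by
      funext j
      ext x
      have := hF.eq_of_commute (g := ⟨x, 0, 0⟩) (h := ⟨0, 0, Pi.single j 1⟩)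
        (by ext k <;> simp)
      rw [explicitCocycle_complement hη0, explicitCocycle_apply] at this
      simpa [Pi.single_apply, apply_ite, hη0] using this.symm
    obtain ⟨p, q, s, μ, ν⟩ := d
    simp only at hp hq hμ hν ⊢
    subst hp hq hμ hν
    have hs : ∀ g h, explicitCocycle τ η ((0, 0, s, 0, 0) : CocycleData n τ K) g h =
        ∑ i, ∑ j, s i j (g.c i * h.b j) := fun g h => by
      simp [explicitCocycle_apply]
    refine ⟨rfl, rfl, rfl, rfl, fun i j hij => ?_, ?_⟩
    · ext x
      have := hF.eq_of_commute (g := ⟨0, 0, Pi.single i x⟩) (h := ⟨0, Pi.single j 1, 0⟩)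
        (by ext k <;> simp [Pi.single_apply, hij])
      rw [hs, hs] at this
      simpa [sum_sum_single_mul_single] using this
    · obtain ⟨ψ, hψ⟩ := hF
      simp only [hs] at hψ
      -- The cocycle vanishes on the centre, so ψ is additive there. The products of c_i = x and b_i
      -- = 1 in the two orders differ by the central element τx, which gives the same m for every i.
      refine ⟨-AddMonoidHom.mk' (fun a => ψ ⟨a, 0, 0⟩) fun a b => ?_, fun i x => ?_⟩
      · have h1 := hψ ⟨a, 0, 0⟩ ⟨b, 0, 0⟩
        have h2 : (⟨a, 0, 0⟩ : HeisenbergVariant n R τ) * ⟨b, 0, 0⟩ = ⟨a + b, 0, 0⟩ := by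
          ext <;> simp
        rw [h2] at h1
        simp only [Pi.zero_apply, mul_zero, map_zero, Finset.sum_const_zero] at h1
        exact (sub_eq_zero.1 h1.symm).symm
      · have h1 := hψ ⟨0, 0, Pi.single i x⟩ ⟨0, Pi.single i 1, 0⟩
        have h2 := hψ ⟨0, Pi.single i 1, 0⟩ ⟨0, 0, Pi.single i x⟩
        have h3 := hψ ⟨τ * x, 0, 0⟩ ⟨0, Pi.single i 1, Pi.single i x⟩
        have e1 : (⟨0, 0, Pi.single i x⟩ : HeisenbergVariant n R τ) * ⟨0, Pi.single i 1, 0⟩ =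
            ⟨τ * x, Pi.single i 1, Pi.single i x⟩ := by
          ext <;> simp [Pi.single_apply]
        have e2 : (⟨0, Pi.single i 1, 0⟩ : HeisenbergVariant n R τ) * ⟨0, 0, Pi.single i x⟩ =
            ⟨0, Pi.single i 1, Pi.single i x⟩ := by
          ext <;> simp
        have e3 : (⟨τ * x, 0, 0⟩ : HeisenbergVariant n R τ) * ⟨0, Pi.single i 1, Pi.single i x⟩ =
            ⟨τ * x, Pi.single i 1, Pi.single i x⟩ := by
          ext <;> simp
        rw [e1, sum_sum_single_mul_single, mul_one] at h1
        rw [e2] at h2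
        rw [e3] at h3
        simp only [Pi.zero_apply, mul_zero, zero_mul, map_zero, Finset.sum_const_zero] at h2 h3
        change s i i x = -ψ ⟨τ * x, 0, 0⟩
        linear_combination (norm := abel) h1 - h2 - h3
  · rintro ⟨hp, hq, hμ, hν, hs, m, hm⟩
    refine ⟨fun g => -m g.a, fun g h => ?_⟩
    have hs' : ∀ i x, (∑ j, d.2.2.1 i j (x * h.b j)) = m (τ * (h.b i * x)) := fun i x => by
      rw [Finset.sum_eq_single i, hm, mul_comm x]
      · intro j _ hj
        rw [hs i j hj.symm, AddMonoidHom.zero_apply]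
      · exact fun hi => absurd (Finset.mem_univ _) hi
    rw [explicitCocycle_apply, hp, hq, hμ, hν]
    simp only [hs', mul_a, Finset.mul_sum, map_add, map_sum]
    simp
    abel

end Kernel

/-! ### Every class is represented by an explicit cocycle. -/

section Surjectivity

variable {n : ℕ} {R : Type*} [CommRing R] {τ : R} {K : Type*} [AddCommGroup K]

theorem normal_mul_complement (a : R) (b c : Fin n → R) :
    (⟨a, b, 0⟩ : HeisenbergVariant n R τ) * ⟨0, 0, c⟩ = ⟨a, b, c⟩ := by
  ext <;> simp

theorem normal_mul_normal (a a' : R) (b b' : Fin n → R) :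
    (⟨a, b, 0⟩ : HeisenbergVariant n R τ) * ⟨a', b', 0⟩ = ⟨a + a', b + b', 0⟩ := by
  ext <;> simp

theorem complement_mul_complement (c c' : Fin n → R) :
    (⟨0, 0, c⟩ : HeisenbergVariant n R τ) * ⟨0, 0, c'⟩ = ⟨0, 0, c + c'⟩ := by
  ext <;> simp

theorem complement_mul_normal (a : R) (b c : Fin n → R) :
    (⟨0, 0, c⟩ : HeisenbergVariant n R τ) * ⟨a, b, 0⟩ = ⟨a + τ * ∑ i, b i * c i, b, c⟩ := by
  ext <;> simp

/-- A cocycle that vanishes on both factors of the semidirect product and on their product in one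
order is determined by its values on their product in the other order. -/
theorem apply_eq_apply_complement_normal
    {f : HeisenbergVariant n R τ → HeisenbergVariant n R τ → K} (hf : IsTwoCocycle f)
    (hN : ∀ a b a' b', f ⟨a, b, 0⟩ ⟨a', b', 0⟩ = 0) (hC : ∀ c c', f ⟨0, 0, c⟩ ⟨0, 0, c'⟩ = 0)
    (hNC : ∀ a b c, f ⟨a, b, 0⟩ ⟨0, 0, c⟩ = 0) (a : R) (b c : Fin n → R)
    (h : HeisenbergVariant n R τ) : f ⟨a, b, c⟩ h = f ⟨0, 0, c⟩ ⟨h.a, h.b, 0⟩ := by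
  have hl : ∀ a b h, f ⟨a, b, 0⟩ h = 0 := fun a b ⟨a', b', c'⟩ => by
    have := hf ⟨a, b, 0⟩ ⟨a', b', 0⟩ ⟨0, 0, c'⟩
    rw [normal_mul_complement, normal_mul_normal, hNC, hNC, hN] at this
    simpa using this.symm
  have hr : ∀ g c, f g ⟨0, 0, c⟩ = 0 := fun ⟨a, b, c⟩ c' => by
    have := hf ⟨a, b, 0⟩ ⟨0, 0, c⟩ ⟨0, 0, c'⟩
    rw [normal_mul_complement, complement_mul_complement, hNC, hNC, hC] at this
    simpa using this
  have h1 := hf ⟨a, b, 0⟩ ⟨0, 0, c⟩ h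
  have h2 := hf ⟨0, 0, c⟩ ⟨h.a, h.b, 0⟩ ⟨0, 0, h.c⟩
  rw [normal_mul_complement, hl, hl] at h1
  rw [normal_mul_complement, hr, hr] at h2
  simp only [add_zero, zero_add] at h1 h2
  rw [h1, h2]

/-- Such a cocycle is a function on C × N, additive in N and a crossed homomorphism in C. Its
restriction to the centre is ν; subtracting the η-correction makes the rest biadditive, which is s.
-/
theorem exists_eq_explicitCocycle_of_normalized (hR : Function.Surjective (Int.cast : ℤ → R))
    {η : R → R} (hη : n = 1 → ∀ x y, η (x + y) = η x + η y + x * y)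
    {f : HeisenbergVariant n R τ → HeisenbergVariant n R τ → K} (hf : IsTwoCocycle f)
    (hN : ∀ a b a' b', f ⟨a, b, 0⟩ ⟨a', b', 0⟩ = 0) (hC : ∀ c c', f ⟨0, 0, c⟩ ⟨0, 0, c'⟩ = 0)
    (hNC : ∀ a b c, f ⟨a, b, 0⟩ ⟨0, 0, c⟩ = 0) :
    ∃ d : CocycleData n τ K, f = explicitCocycle τ η d := by
  have key := apply_eq_apply_complement_normal hf hN hC hNC
  have hadd : ∀ c a b a' b', f ⟨0, 0, c⟩ ⟨a + a', b + b', 0⟩ =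
      f ⟨0, 0, c⟩ ⟨a, b, 0⟩ + f ⟨0, 0, c⟩ ⟨a', b', 0⟩ := fun c a b a' b' => by
    have := hf ⟨0, 0, c⟩ ⟨a, b, 0⟩ ⟨a', b', 0⟩
    rw [normal_mul_normal, complement_mul_normal, hN, key] at this
    rw [zero_add] at this
    rw [← this, add_comm]
  have hcross : ∀ c c' a b, f ⟨0, 0, c + c'⟩ ⟨a, b, 0⟩ =
      f ⟨0, 0, c'⟩ ⟨a, b, 0⟩ + f ⟨0, 0, c⟩ ⟨a + τ * ∑ i, b i * c' i, b, 0⟩ := fun c c' a b => by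
    have := hf ⟨0, 0, c⟩ ⟨0, 0, c'⟩ ⟨a, b, 0⟩
    rw [complement_mul_complement, complement_mul_normal, hC, add_zero] at this
    rw [this, key 0 0 c ⟨a + _, b, c'⟩]
  have hsplit : ∀ c a b, f ⟨0, 0, c⟩ ⟨a, b, 0⟩ = f ⟨0, 0, c⟩ ⟨a, 0, 0⟩ + f ⟨0, 0, c⟩ ⟨0, b, 0⟩ :=
    fun c a b => by rw [← hadd, add_zero, zero_add]
  have hz : ∀ c c' a, f ⟨0, 0, c + c'⟩ ⟨a, 0, 0⟩ =
      f ⟨0, 0, c⟩ ⟨a, 0, 0⟩ + f ⟨0, 0, c'⟩ ⟨a, 0, 0⟩ := fun c c' a => by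
    rw [hcross, add_comm]
    simp
  let ν : Fin n → centralCharacters n τ K := fun j =>
    ⟨AddMonoidHom.mk' (fun x => f ⟨0, 0, Pi.single j 1⟩ ⟨x, 0, 0⟩) fun x y => by
      rw [← hadd, add_zero], fun hn x => by
      obtain ⟨i, hi⟩ : ∃ i : Fin n, i ≠ j := by
        have := Fin.nontrivial_iff_two_le.2 hn
        exact exists_ne j
      change f ⟨0, 0, Pi.single j 1⟩ ⟨τ * x, 0, 0⟩ = 0
      -- Expanding e_j + x e_i in both orders against b = e_i differs only by the action of x e_i on
      -- b, so the discrepancy is ν_j(τx).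
      have h1 := hcross (Pi.single j 1) (Pi.single i x) 0 (Pi.single i 1)
      have h2 := hcross (Pi.single i x) (Pi.single j 1) 0 (Pi.single i 1)
      have e1 : (∑ k, (Pi.single i 1 : Fin n → R) k * (Pi.single i x : Fin n → R) k) = x := by
        simp [Pi.single_apply]
      have e2 : (∑ k, (Pi.single i 1 : Fin n → R) k * (Pi.single j 1 : Fin n → R) k) = 0 := by
        simp [Pi.single_apply, hi.symm]
      rw [e1, hsplit _ (0 + _), zero_add] at h1
      rw [e2, mul_zero, zero_add, add_comm (Pi.single i x : Fin n → R)] at h2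
      linear_combination (norm := abel) h2 - h1⟩
  have hν : ∀ c a, f ⟨0, 0, c⟩ ⟨a, 0, 0⟩ = ∑ j, (ν j).1 (a * c j) := fun c a => by
    rw [← sub_eq_zero]
    refine eq_zero_of_additive_of_closure_eq_top
      (f := fun c => f ⟨0, 0, c⟩ ⟨a, 0, 0⟩ - ∑ j, (ν j).1 (a * c j)) (fun c c' => ?_)
      (Pi.closure_range_single_one hR n) ?_ c
    · simp only [hz, Pi.add_apply, mul_add, map_add, Finset.sum_add_distrib]
      abel
    · rintro _ ⟨i, rfl⟩
      change _ - ∑ j, (ν j).1 (a * (Pi.single i 1 : Fin n → R) j) = 0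
      rw [sum_apply_mul_single (fun j => (ν j).1), mul_one]
      exact sub_self _
  let ρ : (Fin n → R) → (Fin n → R) → K := fun c b =>
    f ⟨0, 0, c⟩ ⟨0, b, 0⟩ - ∑ j, (ν j).1 (τ * (b j * η (c j)))
  have hρr : ∀ c b b', ρ c (b + b') = ρ c b + ρ c b' := fun c b b' => by
    have := hadd c 0 b 0 b'
    rw [add_zero] at this
    simp only [ρ, this, Pi.add_apply, add_mul, mul_add, map_add, Finset.sum_add_distrib]
    abel
  have hρl : ∀ c c' b, ρ (c + c') b = ρ c b + ρ c' b := fun c c' b => by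
    have h1 := hcross c c' 0 b
    rw [hsplit c, zero_add, hν] at h1
    have h2 : ∑ j, (ν j).1 (τ * ((∑ i, b i * c' i) * c j +
        b j * (η (c j) + η (c' j) - η (c' j + c j)))) = 0 := by
      refine Finset.sum_eq_zero fun j _ => ?_
      have := centralCharacters_apply_eq_zero hη (ν j).2 c' b (c j) j
      simpa only [mul_comm (c' _)] using this
    simp only [mul_add, mul_sub, map_add, map_sub, Finset.sum_add_distrib,
      Finset.sum_sub_distrib, ← mul_assoc] at h2
    simp only [ρ, h1, Pi.add_apply, add_comm (c _), ← mul_assoc]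
    linear_combination (norm := abel) h2
  let s : Fin n → Fin n → R →+ K := fun i j =>
    AddMonoidHom.mk' (fun x => ρ (Pi.single i 1) (Pi.single j x)) fun x y => by
      rw [← hρr, Pi.single_add]
  have hs : ∀ c b, ρ c b = ∑ i, ∑ j, s i j (c i * b j) := fun c b => by
    rw [← sub_eq_zero]
    refine eq_zero_of_biadditive_of_closure_eq_top
      (f := fun c b => ρ c b - ∑ i, ∑ j, s i j (c i * b j)) (fun c c' b => ?_)
      (fun c b b' => ?_) (Pi.closure_range_single_one hR n)
      (Pi.closure_iUnion_range_single n) ?_ c b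
    · simp only [hρl, Pi.add_apply, add_mul, map_add, Finset.sum_add_distrib]
      abel
    · simp only [hρr, Pi.add_apply, mul_add, map_add, Finset.sum_add_distrib]
      abel
    · rintro _ ⟨i, rfl⟩ y hy
      obtain ⟨j, x, rfl⟩ := Set.mem_iUnion.1 hy
      simp only [sum_sum_single_mul_single, one_mul]
      exact sub_self _
  refine ⟨(0, 0, s, 0, ν), ?_⟩
  funext ⟨a, b, c⟩ h
  rw [explicitCocycle_zero_zero_zero, key, hsplit, hν, ← hs]
  simp only [ρ, map_add, Finset.sum_add_distrib]
  abel

/-- Every cocycle becomes symmetric on the two abelian factors of the semidirect product after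
subtracting an explicit one. -/
theorem exists_symmetric_sub_explicitCocycle (hR : Function.Surjective (Int.cast : ℤ → R))
    {η : R → R} (hη0 : η 0 = 0) (hη : n = 1 → ∀ x y, η (x + y) = η x + η y + x * y)
    {f : HeisenbergVariant n R τ → HeisenbergVariant n R τ → K} (hf : IsTwoCocycle f) :
    ∃ d : CocycleData n τ K,
      (∀ a b a' b', (f - explicitCocycle τ η d) ⟨a, b, 0⟩ ⟨a', b', 0⟩ =
        (f - explicitCocycle τ η d) ⟨a', b', 0⟩ ⟨a, b, 0⟩) ∧
      ∀ c c', (f - explicitCocycle τ η d) ⟨0, 0, c⟩ ⟨0, 0, c'⟩ =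
        (f - explicitCocycle τ η d) ⟨0, 0, c'⟩ ⟨0, 0, c⟩ := by
  have hcN : ∀ a a' b b', (⟨a, b, 0⟩ : HeisenbergVariant n R τ) * ⟨a', b', 0⟩ =
      ⟨a', b', 0⟩ * ⟨a, b, 0⟩ := fun a a' b b' => by
    rw [normal_mul_normal, normal_mul_normal, add_comm a, add_comm b]
  have hcC : ∀ c c', (⟨0, 0, c⟩ : HeisenbergVariant n R τ) * ⟨0, 0, c'⟩ =
      ⟨0, 0, c'⟩ * ⟨0, 0, c⟩ := fun c c' => by
    rw [complement_mul_complement, complement_mul_complement, add_comm c]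
  let p : {u : Fin n × Fin n // u.1 < u.2} → R →+ K := fun u =>
    AddMonoidHom.mk' (fun x => f ⟨0, Pi.single u.1.1 x, 0⟩ ⟨0, Pi.single u.1.2 1, 0⟩ -
      f ⟨0, Pi.single u.1.2 1, 0⟩ ⟨0, Pi.single u.1.1 x, 0⟩) fun x y => by
      rw [← hf.commutator_mul_left (hcN _ _ _ _) (hcN _ _ _ _), normal_mul_normal, Pi.single_add,
        add_zero]
  let q : {u : Fin n × Fin n // u.1 < u.2} → R →+ K := fun u =>
    AddMonoidHom.mk' (fun x => f ⟨0, 0, Pi.single u.1.1 x⟩ ⟨0, 0, Pi.single u.1.2 1⟩ -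
      f ⟨0, 0, Pi.single u.1.2 1⟩ ⟨0, 0, Pi.single u.1.1 x⟩) fun x y => by
      rw [← hf.commutator_mul_left (hcC _ _) (hcC _ _), complement_mul_complement, Pi.single_add]
  let μ : Fin n → centralCharacters n τ K := fun j =>
    ⟨AddMonoidHom.mk' (fun x => f ⟨x, 0, 0⟩ ⟨0, Pi.single j 1, 0⟩ -
      f ⟨0, Pi.single j 1, 0⟩ ⟨x, 0, 0⟩) fun x y => by
      rw [← hf.commutator_mul_left (hcN _ _ _ _) (hcN _ _ _ _), normal_mul_normal, add_zero],
      fun hn x => by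
      obtain ⟨i, hi⟩ : ∃ i : Fin n, i ≠ j := by
        have := Fin.nontrivial_iff_two_le.2 hn
        exact exists_ne j
      change f ⟨τ * x, 0, 0⟩ ⟨0, Pi.single j 1, 0⟩ - f ⟨0, Pi.single j 1, 0⟩ ⟨τ * x, 0, 0⟩ = 0
      -- Conjugation by c = x e_i moves b = e_i by the central τx and fixes b = e_j. Invariance and
      -- additivity of the commutator pairing then kill its value on (τx, e_j).
      have h1 := hf.commutator_mul_left
        (hcN (τ * x) 0 0 (Pi.single j 1)) (hcN 0 0 (Pi.single i 1) (Pi.single j 1))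
      have h2 := hf.commutator_conj (g := ⟨0, 0, Pi.single i x⟩)
        (x' := ⟨τ * x, Pi.single i 1, 0⟩) (y' := ⟨0, Pi.single j 1, 0⟩)
        (hcN 0 0 (Pi.single i 1) (Pi.single j 1))
        (by ext <;> simp [Pi.single_apply]) (by ext <;> simp [Pi.single_apply, hi])
        (hcN _ _ _ _)
      rw [normal_mul_normal, add_zero, zero_add, h2] at h1
      exact left_eq_add.1 (h1.trans (add_comm _ _))⟩
  refine ⟨(p, q, 0, μ, 0), fun a b a' b' => ?_, fun c c' => ?_⟩
  · have hF := hf.sub (isTwoCocycle_explicitCocycle hη (p, q, 0, μ, 0))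
    have hE := explicitCocycle_normal hη0 ((p, q, 0, μ, 0) : CocycleData n τ K)
    set F := f - explicitCocycle τ η (p, q, 0, μ, 0) with hFdef
    have hFE : ∀ g h, F g h = f g h - explicitCocycle τ η (p, q, 0, μ, 0) g h := fun _ _ => rfl
    -- The commutator pairing on N is biadditive, so it suffices that it vanishes on generators,
    -- where p and μ were chosen to cancel it.
    let B : R × (Fin n → R) → R × (Fin n → R) → K := fun x y =>
      F ⟨x.1, x.2, 0⟩ ⟨y.1, y.2, 0⟩ - F ⟨y.1, y.2, 0⟩ ⟨x.1, x.2, 0⟩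
    have hskew : ∀ x y, B x y = 0 → B y x = 0 := fun x y h => by
      rw [← neg_eq_zero, ← h]
      exact neg_sub _ _
    rw [← sub_eq_zero]
    refine eq_zero_of_biadditive_of_closure_eq_top (f := B) (fun x y z => ?_) (fun x y z => ?_)
      (Prod.closure_range_single_one hR n) (Prod.closure_range_single_one hR n) ?_ (a, b) (a', b')
    · have := hF.commutator_mul_left (hcN x.1 z.1 x.2 z.2) (hcN y.1 z.1 y.2 z.2)
      rwa [normal_mul_normal] at this
    · have := hF.commutator_mul_right (hcN y.1 x.1 y.2 x.2) (hcN z.1 x.1 z.2 x.2)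
      rwa [normal_mul_normal] at this
    · have h1 : ∀ j, B (1, 0) (0, Pi.single j 1) = 0 := fun j => by
        simp only [B, hFE, hE]
        rw [sum_apply_mul_single (fun j => (μ j).1)]
        simp only [Pi.zero_apply, mul_zero, zero_mul, map_zero, Finset.sum_const_zero, mul_one]
        simp [μ]
      have h2 : ∀ i j, i < j → B (0, Pi.single i 1) (0, Pi.single j 1) = 0 := fun i j hij => by
        simp only [B, hFE, hE, sum_lt_single_mul_single]
        simp [hij, hij.not_gt, p]
      rintro x (rfl | ⟨i, rfl⟩) y (rfl | ⟨j, rfl⟩)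
      · exact sub_self _
      · exact h1 j
      · exact hskew _ _ (h1 i)
      · rcases lt_trichotomy i j with hij | rfl | hij
        · exact h2 i j hij
        · exact sub_self _
        · exact hskew _ _ (h2 j i hij)
  · have hF := hf.sub (isTwoCocycle_explicitCocycle hη (p, q, 0, μ, 0))
    have hE := explicitCocycle_complement hη0 ((p, q, 0, μ, 0) : CocycleData n τ K)
    set F := f - explicitCocycle τ η (p, q, 0, μ, 0) with hFdef
    have hFE : ∀ g h, F g h = f g h - explicitCocycle τ η (p, q, 0, μ, 0) g h := fun _ _ => rfl
    let B : (Fin n → R) → (Fin n → R) → K := fun x y =>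
      F ⟨0, 0, x⟩ ⟨0, 0, y⟩ - F ⟨0, 0, y⟩ ⟨0, 0, x⟩
    have hskew : ∀ x y, B x y = 0 → B y x = 0 := fun x y h => by
      rw [← neg_eq_zero, ← h]
      exact neg_sub _ _
    rw [← sub_eq_zero]
    refine eq_zero_of_biadditive_of_closure_eq_top (f := B) (fun x y z => ?_) (fun x y z => ?_)
      (Pi.closure_range_single_one hR n) (Pi.closure_range_single_one hR n) ?_ c c'
    · have := hF.commutator_mul_left (hcC x z) (hcC y z)
      rwa [complement_mul_complement] at this
    · have := hF.commutator_mul_right (hcC y x) (hcC z x)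
      rwa [complement_mul_complement] at this
    · have h2 : ∀ i j, i < j → B (Pi.single i 1) (Pi.single j 1) = 0 := fun i j hij => by
        simp only [B, hFE, hE, sum_lt_single_mul_single]
        simp [hij, hij.not_gt, q]
      rintro _ ⟨i, rfl⟩ _ ⟨j, rfl⟩
      rcases lt_trichotomy i j with hij | rfl | hij
      · exact h2 i j hij
      · exact sub_self _
      · exact hskew _ _ (h2 j i hij)

theorem exists_isTwoCoboundary_sub_explicitCocycle [DivisibleBy K ℤ]
    (hR : Function.Surjective (Int.cast : ℤ → R))
    {η : R → R} (hη0 : η 0 = 0) (hη : n = 1 → ∀ x y, η (x + y) = η x + η y + x * y)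
    {f : HeisenbergVariant n R τ → HeisenbergVariant n R τ → K} (hf : IsTwoCocycle f) :
    ∃ d : CocycleData n τ K, IsTwoCoboundary (f - explicitCocycle τ η d) := by
  obtain ⟨d, hdN, hdC⟩ := exists_symmetric_sub_explicitCocycle hR hη0 hη hf
  have hF := hf.sub (isTwoCocycle_explicitCocycle hη d)
  set F := f - explicitCocycle τ η d with hFdef
  obtain ⟨ψN, hψN⟩ := exists_eq_add_sub_of_symmetric
    (f := fun x y : R × (Fin n → R) => F ⟨x.1, x.2, 0⟩ ⟨y.1, y.2, 0⟩) (fun x y z => by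
      have := hF ⟨x.1, x.2, 0⟩ ⟨y.1, y.2, 0⟩ ⟨z.1, z.2, 0⟩
      rwa [normal_mul_normal, normal_mul_normal] at this) fun x y => hdN _ _ _ _
  obtain ⟨ψC, hψC⟩ := exists_eq_add_sub_of_symmetric
    (f := fun x y : Fin n → R => F ⟨0, 0, x⟩ ⟨0, 0, y⟩) (fun x y z => by
      have := hF ⟨0, 0, x⟩ ⟨0, 0, y⟩ ⟨0, 0, z⟩
      rwa [complement_mul_complement, complement_mul_complement] at this) fun x y => hdC _ _
  have hN0 : ∀ x : R × (Fin n → R), F ⟨x.1, x.2, 0⟩ ⟨0, 0, 0⟩ = ψN 0 := fun x => by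
    have := hψN x 0
    rw [add_zero, add_sub_cancel_left] at this
    exact this
  have hC0 : ∀ c, F ⟨0, 0, 0⟩ ⟨0, 0, c⟩ = ψC 0 := fun c => by
    have := hψC 0 c
    rw [zero_add, add_sub_cancel_right] at this
    exact this
  have h00 : ψN 0 = ψC 0 := (hN0 0).symm.trans (hC0 0)
  -- Chosen to extend both splittings, compatible at the identity by `h00`, and to make `F` minus
  -- its coboundary vanish on N × C as well.
  let ψ : HeisenbergVariant n R τ → K := fun g =>
    ψN (g.a, g.b) + ψC g.c - F ⟨g.a, g.b, 0⟩ ⟨0, 0, g.c⟩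
  have hψa : ∀ a b, ψ ⟨a, b, 0⟩ = ψN (a, b) := fun a b => by
    have : F ⟨a, b, 0⟩ ⟨0, 0, 0⟩ = ψN 0 := hN0 (a, b)
    simp only [ψ, this, h00, add_sub_cancel_right]
  have hψc : ∀ c, ψ ⟨0, 0, c⟩ = ψC c := fun c => by
    change ψN 0 + ψC c - F ⟨0, 0, 0⟩ ⟨0, 0, c⟩ = ψC c
    rw [hC0, h00, add_sub_cancel_left]
  let δ : HeisenbergVariant n R τ → HeisenbergVariant n R τ → K := fun g h =>
    ψ g + ψ h - ψ (g * h)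
  have hδ : IsTwoCoboundary δ := ⟨ψ, fun _ _ => rfl⟩
  obtain ⟨d', hd'⟩ := exists_eq_explicitCocycle_of_normalized hR hη (hF.sub hδ.isTwoCocycle)
    (fun a b a' b' => by
      have : F ⟨a, b, 0⟩ ⟨a', b', 0⟩ = _ := hψN (a, b) (a', b')
      simp only [Pi.sub_apply, δ, normal_mul_normal, hψa, this, Prod.mk_add_mk, sub_self])
    (fun c c' => by
      have : F ⟨0, 0, c⟩ ⟨0, 0, c'⟩ = _ := hψC c c'
      simp only [Pi.sub_apply, δ, complement_mul_complement, hψc, this, sub_self])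
    (fun a b c => by
      simp only [Pi.sub_apply, δ, normal_mul_complement, hψc, hψa]
      simp only [ψ]
      abel)
  refine ⟨d + d', ?_⟩
  rw [map_add, ← hd', ← sub_sub, ← hFdef, sub_sub_cancel]
  exact hδ

end Surjectivity

end HeisenbergVariant

/-! ### Divisibility and torsion of ℂˣ. -/

section ComplexUnits

theorem Complex.units_exists_pow_eq {m : ℕ} (hm : m ≠ 0) (z : ℂˣ) : ∃ w : ℂˣ, w ^ m = z := by
  obtain ⟨w, hw⟩ := IsAlgClosed.exists_pow_nat_eq (z : ℂ) (Nat.pos_of_ne_zero hm)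
  have hw0 : w ≠ 0 := fun h => z.ne_zero (by rw [← hw, h, zero_pow hm])
  exact ⟨Units.mk0 w hw0, Units.ext (by simpa using hw)⟩

theorem Complex.additive_units_exists_zsmul_eq {t : ℤ} (ht : t ≠ 0) (z : Additive ℂˣ) :
    ∃ w : Additive ℂˣ, t • w = z := by
  obtain ⟨w, hw⟩ := Complex.units_exists_pow_eq (Int.natAbs_ne_zero.2 ht) z.toMul
  have hw' : t.natAbs • Additive.ofMul w = z := hw
  rcases Int.natAbs_eq t with h | h
  · exact ⟨Additive.ofMul w, by rw [h, natCast_zsmul, hw']⟩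
  · exact ⟨-Additive.ofMul w, by rw [h, neg_smul, smul_neg, neg_neg, natCast_zsmul, hw']⟩

noncomputable instance : DivisibleBy (Additive ℂˣ) ℤ :=
  divisibleByOfSMulRightSurj _ _ fun ht => Complex.additive_units_exists_zsmul_eq ht

theorem Complex.nonempty_torsion_addEquiv_zmod {m : ℕ} (hm : m ≠ 0) :
    Nonempty ((nsmulAddMonoidHom m : Additive ℂˣ →+ Additive ℂˣ).ker ≃+ ZMod m) := by
  have : NeZero m := ⟨hm⟩
  let e : (nsmulAddMonoidHom m : Additive ℂˣ →+ Additive ℂˣ).ker ≃+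
      Additive (rootsOfUnity m ℂ) :=
    { toFun := fun x => Additive.ofMul ⟨x.1.toMul, x.2⟩
      invFun := fun x => ⟨Additive.ofMul x.toMul.1, x.toMul.2⟩
      left_inv := fun _ => rfl
      right_inv := fun _ => rfl
      map_add' := fun _ _ => rfl }
  have hcard : Nat.card (Additive (rootsOfUnity m ℂ)) = m := Complex.card_rootsOfUnity m
  have hc : IsAddCyclic (Additive (rootsOfUnity m ℂ)) := inferInstance
  have f := zmodAddCyclicAddEquiv hc
  rw [hcard] at f
  exact ⟨e.trans f.symm⟩

end ComplexUnits

/-! ### Characters of `ZMod r`. -/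

section Characters

variable {K : Type*} [AddCommGroup K]

theorem ZMod.exists_addMonoidHom_apply_one (r : ℕ) {k : K} (hk : r • k = 0) :
    ∃ m : ZMod r →+ K, m 1 = k := by
  refine ⟨ZMod.lift r ⟨zmultiplesHom K k, by simpa using hk⟩, ?_⟩
  have := ZMod.lift_coe r ⟨zmultiplesHom K k, by simpa using hk⟩ 1
  simpa using this

theorem ZMod.addMonoidHom_apply_intCast {r : ℕ} (m : ZMod r →+ K) (k : ℤ) :
    m (k : ZMod r) = k • m 1 := by
  rw [← zsmul_one, map_zsmul]

theorem ZMod.addMonoidHom_apply_intCast_mul {r : ℕ} (m : ZMod r →+ K) (k : ℤ) (x : ZMod r) :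
    m ((k : ZMod r) * x) = k • m x := by
  rw [← zsmul_eq_mul, map_zsmul]

theorem ZMod.addMonoidHom_ext_one {r : ℕ} {m m' : ZMod r →+ K} (h : m 1 = m' 1) : m = m' := by
  ext x
  obtain ⟨k, rfl⟩ := ZMod.intCast_surjective x
  rw [ZMod.addMonoidHom_apply_intCast, ZMod.addMonoidHom_apply_intCast, h]

variable (K) in
/-- Characters of `ZMod r` killed by a divisor `t` of `r` correspond to the `t`-torsion. -/
theorem HeisenbergVariant.nonempty_centralCharacters_addEquiv {n r : ℕ} {t : ℤ} (hn : 1 < n)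
    (htr : t ∣ (r : ℤ)) :
    Nonempty (HeisenbergVariant.centralCharacters n (t : ZMod r) K ≃+
      (nsmulAddMonoidHom t.natAbs : K →+ K).ker) := by
  have h : ∀ k : K, t.natAbs • k = 0 ↔ t • k = 0 := fun k => by
    rw [← natCast_zsmul]
    rcases Int.natAbs_eq t with h | h
    · rw [← h]
    · rw [h, neg_smul, neg_eq_zero, Int.natAbs_neg, Int.natAbs_natCast]
  let e : HeisenbergVariant.centralCharacters n (t : ZMod r) K →+
      (nsmulAddMonoidHom t.natAbs : K →+ K).ker :=
    AddMonoidHom.mk' (fun m => ⟨m.1 1, (h _).2 (by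
      rw [← ZMod.addMonoidHom_apply_intCast_mul]; exact m.2 hn 1)⟩) fun m m' => rfl
  refine ⟨AddEquiv.ofBijective e ⟨fun m m' hm => Subtype.ext
    (ZMod.addMonoidHom_ext_one (congrArg Subtype.val hm)), fun k => ?_⟩⟩
  have hk : t • k.1 = 0 := (h _).1 k.2
  have hr : r • k.1 = 0 := by
    obtain ⟨s, hs⟩ := htr
    rw [← natCast_zsmul, hs, mul_comm, mul_smul, hk, smul_zero]
  obtain ⟨m, hm⟩ := ZMod.exists_addMonoidHom_apply_one r hr
  refine ⟨⟨m, fun _ x => ?_⟩, Subtype.ext hm⟩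
  obtain ⟨a, rfl⟩ := ZMod.intCast_surjective x
  rw [ZMod.addMonoidHom_apply_intCast_mul, ZMod.addMonoidHom_apply_intCast, hm, smul_comm, hk,
    smul_zero]

variable (K) in
theorem ZMod.nonempty_addMonoidHom_addEquiv (r : ℕ) :
    Nonempty ((ZMod r →+ K) ≃+ (nsmulAddMonoidHom r : K →+ K).ker) := by
  let e : (ZMod r →+ K) →+ (nsmulAddMonoidHom r : K →+ K).ker :=
    AddMonoidHom.mk' (fun m => ⟨m 1, by
      change r • m 1 = 0
      rw [← map_nsmul, nsmul_one, ZMod.natCast_self, map_zero]⟩) fun m m' => rfl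
  refine ⟨AddEquiv.ofBijective e ⟨fun m m' hm =>
    ZMod.addMonoidHom_ext_one (congrArg Subtype.val hm), fun k => ?_⟩⟩
  obtain ⟨m, hm⟩ := ZMod.exists_addMonoidHom_apply_one r k.2
  exact ⟨m, Subtype.ext hm⟩

theorem HeisenbergVariant.nonempty_centralCharacters_one_addEquiv {R : Type*} [CommRing R] (τ : R) :
    Nonempty (HeisenbergVariant.centralCharacters 1 τ K ≃+ (R →+ K)) :=
  ⟨AddEquiv.ofBijective (AddSubgroup.subtype _)
    ⟨Subtype.val_injective, fun m => ⟨⟨m, fun h => absurd h (lt_irrefl 1)⟩, rfl⟩⟩⟩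

/-- The cokernel of multiplication by a divisor `t` of `r` on the characters of `ZMod r`. -/
theorem ZMod.exists_cokernel_mul {r : ℕ} {t : ℤ} (htr : t ∣ (r : ℤ))
    (e : (ZMod r →+ K) ≃+ ZMod r) :
    ∃ κ : (ZMod r →+ K) →+ ZMod t.natAbs, Function.Surjective κ ∧
      ∀ m, κ m = 0 ↔ ∃ m' : ZMod r →+ K, ∀ x, m x = m' ((t : ZMod r) * x) := by
  have hd : t.natAbs ∣ r := Int.natAbs_dvd_natAbs.2 htr
  let c := ZMod.castHom hd (ZMod t.natAbs)
  refine ⟨c.toAddMonoidHom.comp e.toAddMonoidHom,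
    (ZMod.castHom_surjective hd).comp e.surjective, fun m => ?_⟩
  -- Precomposition with t is multiplication by t on characters, so through `e` the cokernel is
  -- `ZMod r` reduced modulo t.
  have h1 : (∃ m' : ZMod r →+ K, ∀ x, m x = m' ((t : ZMod r) * x)) ↔ ∃ m', m = t • m' := by
    refine exists_congr fun m' => ?_
    rw [DFunLike.ext_iff]
    exact forall_congr' fun x => by rw [ZMod.addMonoidHom_apply_intCast_mul]; rfl
  rw [h1]
  change c (e m) = 0 ↔ _
  constructor
  · intro h
    obtain ⟨k, hk⟩ := ZMod.intCast_surjective (e m)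
    rw [← hk, map_intCast, ZMod.intCast_zmod_eq_zero_iff_dvd] at h
    obtain ⟨l, hl⟩ := Int.natAbs_dvd.1 h
    refine ⟨e.symm (l : ZMod r), e.injective ?_⟩
    rw [map_zsmul, e.apply_symm_apply, ← hk, hl, Int.cast_mul, zsmul_eq_mul]
  · rintro ⟨m', rfl⟩
    rw [map_zsmul, map_zsmul, zsmul_eq_mul]
    have : ((t : ℤ) : ZMod t.natAbs) = 0 :=
      (ZMod.intCast_zmod_eq_zero_iff_dvd _ _).2 (Int.natAbs_dvd.2 dvd_rfl)
    rw [this, zero_mul]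

end Characters

/-! ### Counting index pairs. -/

section Counting

theorem Fintype.card_lt_pairs (n : ℕ) :
    Fintype.card {u : Fin n × Fin n // u.1 < u.2} * 2 = n * (n - 1) := by
  let e : {u : Fin n × Fin n // u.1 < u.2} ≃ Σ j : Fin n, Fin j :=
    { toFun := fun u => ⟨u.1.2, ⟨u.1.1, u.2⟩⟩
      invFun := fun s => ⟨(⟨s.2, s.2.2.trans s.1.2⟩, s.1), s.2.2⟩
      left_inv := fun _ => rfl
      right_inv := fun _ => rfl }
  rw [Fintype.card_congr e, Fintype.card_sigma, ← Finset.sum_range_id_mul_two]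
  simp only [Fintype.card_fin]
  rw [Fin.sum_univ_eq_sum_range (fun i => i)]

theorem Fintype.card_ne_pairs (n : ℕ) :
    Fintype.card {u : Fin n × Fin n // u.1 ≠ u.2} = n * (n - 1) := by
  rw [Fintype.card_subtype, Nat.mul_sub, mul_one]
  have := Finset.offDiag_card (Finset.univ : Finset (Fin n))
  rw [Finset.card_univ, Fintype.card_fin] at this
  rw [← this]
  congr 1
  ext u
  simp

end Counting

/-! ### Assembly of the Schur multiplier. -/

namespace HeisenbergVariant

/-- The diagonal of s is recorded as its differences from the entry at `i₀`, together with the class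
of that entry under κ: a coboundary shifts all diagonal entries by one common x ↦ m(τx). -/
theorem nonempty_schurMultiplier_addEquiv_pi {n : ℕ} (hn : 0 < n) {R : Type} [CommRing R]
    (hR : Function.Surjective (Int.cast : ℤ → R)) (τ : R) {η : R → R} (hη0 : η 0 = 0)
    (hη : n = 1 → ∀ x y, η (x + y) = η x + η y + x * y) {M T Q : Type*} [AddCommGroup M]
    [AddCommGroup T] [AddCommGroup Q] (eM : (R →+ Additive ℂˣ) ≃+ M)
    (eT : centralCharacters n τ (Additive ℂˣ) ≃+ T) (κ : (R →+ Additive ℂˣ) →+ Q)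
    (hκ : Function.Surjective κ)
    (hκ0 : ∀ m, κ m = 0 ↔ ∃ m' : R →+ Additive ℂˣ, ∀ x, m x = m' (τ * x)) :
    Nonempty (SchurMultiplier (HeisenbergVariant n R τ) ≃+
      (Fin (2 * n ^ 2 - n - 1) → M) × Q × (Fin (2 * n) → T)) := by
  let i₀ : Fin n := ⟨0, hn⟩
  let U := {u : Fin n × Fin n // u.1 < u.2}
  let I := (U ⊕ U) ⊕ ({u : Fin n × Fin n // u.1 ≠ u.2} ⊕ {i : Fin n // i ≠ i₀})
  let π : CocycleData n τ (Additive ℂˣ) →+ (I → R →+ Additive ℂˣ) × Q ×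
      (Fin n ⊕ Fin n → centralCharacters n τ (Additive ℂˣ)) :=
    AddMonoidHom.mk' (fun d : CocycleData n τ (Additive ℂˣ) =>
      (Sum.elim (Sum.elim d.1 d.2.1)
        (Sum.elim (fun u : {u : Fin n × Fin n // u.1 ≠ u.2} => d.2.2.1 u.1.1 u.1.2)
          fun i : {i : Fin n // i ≠ i₀} => d.2.2.1 i i - d.2.2.1 i₀ i₀),
        κ (d.2.2.1 i₀ i₀), Sum.elim d.2.2.2.1 d.2.2.2.2)) fun d d' => by
      refine Prod.ext ?_ (Prod.ext (map_add κ _ _) ?_)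
      · funext i
        rcases i with (i | i) | (i | i)
        · rfl
        · rfl
        · rfl
        · exact add_sub_add_comm _ _ _ _
      · funext i
        rcases i with i | i <;> rfl
  have hπ : Function.Surjective π := by
    rintro ⟨x, y, z⟩
    obtain ⟨m, rfl⟩ := hκ y
    let s : Fin n → Fin n → R →+ Additive ℂˣ := fun i j =>
      if h : i ≠ j then x (Sum.inr (Sum.inl ⟨(i, j), h⟩))
      else if h : i ≠ i₀ then x (Sum.inr (Sum.inr ⟨i, h⟩)) + m else m
    have hs0 : s i₀ i₀ = m := by simp [s]
    refine ⟨(fun u => x (Sum.inl (Sum.inl u)), fun u => x (Sum.inl (Sum.inr u)), s,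
      fun i => z (Sum.inl i), fun i => z (Sum.inr i)), ?_⟩
    refine Prod.ext ?_ (Prod.ext (congrArg κ hs0) ?_)
    · funext i
      rcases i with (i | i) | (⟨⟨i, j⟩, h⟩ | ⟨i, h⟩)
      · rfl
      · rfl
      · exact dif_pos h
      · change s i i - s i₀ i₀ = _
        rw [hs0]
        have hs : s i i = x (Sum.inr (Sum.inr ⟨i, h⟩)) + m := by simp [s, h]
        rw [hs]
        ext1 y
        exact add_sub_cancel_right (x (Sum.inr (Sum.inr ⟨i, h⟩)) y) (m y)
    · funext i
      rcases i with i | i <;> rfl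
  have hker : ∀ d, IsTwoCoboundary (explicitCocycle τ η d) ↔ π d = 0 := by
    intro d
    rw [isTwoCoboundary_explicitCocycle_iff hη0]
    constructor
    · rintro ⟨hp, hq, hμ, hν, hs, m, hm⟩
      have hd : ∀ i j, d.2.2.1 i i = d.2.2.1 j j := fun i j => by ext1 x; rw [hm, hm]
      refine Prod.ext ?_ (Prod.ext ((hκ0 _).2 ⟨m, hm i₀⟩) ?_)
      · funext i
        rcases i with (i | i) | (i | i)
        · exact congrFun hp i
        · exact congrFun hq i
        · exact hs _ _ i.2
        · exact sub_eq_zero.2 (hd _ _)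
      · funext i
        rcases i with i | i
        · exact congrFun hμ i
        · exact congrFun hν i
    · intro h
      have h1 := congrArg Prod.fst h
      have h2 := congrArg (fun x => x.2.1) h
      have h3 := congrArg (fun x => x.2.2) h
      obtain ⟨m, hm⟩ := (hκ0 _).1 h2
      refine ⟨funext fun u => congrFun h1 (Sum.inl (Sum.inl u)),
        funext fun u => congrFun h1 (Sum.inl (Sum.inr u)),
        funext fun i => congrFun h3 (Sum.inl i), funext fun i => congrFun h3 (Sum.inr i),
        fun i j hij => congrFun h1 (Sum.inr (Sum.inl ⟨(i, j), hij⟩)), m, fun i x => ?_⟩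
      rw [← hm]
      by_cases hi : i = i₀
      · rw [hi]
      · have hd : d.2.2.1 i i = d.2.2.1 i₀ i₀ :=
          sub_eq_zero.1 (congrFun h1 (Sum.inr (Sum.inr ⟨i, hi⟩)))
        rw [hd]
  obtain ⟨e⟩ := nonempty_schurMultiplier_addEquiv (T := (I → R →+ Additive ℂˣ) × Q ×
      (Fin n ⊕ Fin n → centralCharacters n τ (Additive ℂˣ))) (explicitCocycle τ η)
    (isTwoCocycle_explicitCocycle hη) π hπ hker
    fun f hf => exists_isTwoCoboundary_sub_explicitCocycle hR hη0 hη hf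
  have hI : Fintype.card I = 2 * n ^ 2 - n - 1 := by
    have h1 := Fintype.card_lt_pairs n
    have h2 := Fintype.card_ne_pairs n
    have h3 : Fintype.card {i : Fin n // i ≠ i₀} = n - 1 := by
      rw [Fintype.card_subtype_compl, Fintype.card_fin, Fintype.card_subtype_eq]
    simp only [I, U, Fintype.card_sum, h2, h3]
    obtain ⟨k, rfl⟩ : ∃ k, n = k + 1 := ⟨n - 1, by omega⟩
    rw [← mul_two, h1]
    simp only [Nat.add_sub_cancel]
    have : 2 * (k + 1) ^ 2 = 2 * ((k + 1) * k) + 2 * (k + 1) := by ring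
    omega
  have hJ : Fintype.card (Fin n ⊕ Fin n) = 2 * n := by
    rw [Fintype.card_sum, Fintype.card_fin, two_mul]
  let e₁ : (I → R →+ Additive ℂˣ) ≃+ (Fin (2 * n ^ 2 - n - 1) → M) :=
    AddEquiv.arrowCongr (Fintype.equivFinOfCardEq hI) eM
  let e₂ : (Fin n ⊕ Fin n → centralCharacters n τ (Additive ℂˣ)) ≃+ (Fin (2 * n) → T) :=
    AddEquiv.arrowCongr (Fintype.equivFinOfCardEq hJ) eT
  let e' : ((I → R →+ Additive ℂˣ) × Q ×
      (Fin n ⊕ Fin n → centralCharacters n τ (Additive ℂˣ))) ≃+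
        (Fin (2 * n ^ 2 - n - 1) → M) × Q × (Fin (2 * n) → T) :=
    { e₁.toEquiv.prodCongr ((Equiv.refl Q).prodCongr e₂.toEquiv) with
      map_add' := fun x y => Prod.ext (map_add e₁ _ _) (Prod.ext rfl (map_add e₂ _ _)) }
  exact ⟨e.trans e'⟩

/-- Take η(x) = x²/2; for modulus 2k + 1 the inverse of 2 is k + 1. -/
theorem exists_quadratic_of_odd {r : ℕ} (hr : Odd r) :
    ∃ η : ZMod r → ZMod r, η 0 = 0 ∧ ∀ x y, η (x + y) = η x + η y + x * y := by
  obtain ⟨k, rfl⟩ := hr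
  have h2 : (2 : ZMod (2 * k + 1)) * (k + 1 : ℕ) = 1 := by
    have : ((2 * k + 1 : ℕ) : ZMod (2 * k + 1)) = 0 := ZMod.natCast_self _
    push_cast at this ⊢
    linear_combination this
  refine ⟨fun x => (k + 1 : ℕ) * x ^ 2, by simp, fun x y => ?_⟩
  linear_combination (x * y) * h2

/-- Over ℤ the binomial coefficient x(x - 1)/2 replaces x²/2. -/
theorem exists_quadratic_int :
    ∃ η : ZMod 0 → ZMod 0, η 0 = 0 ∧ ∀ x y, η (x + y) = η x + η y + x * y := by
  let η : ℤ → ℤ := fun x => x * (x - 1) / 2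
  have h : ∀ x : ℤ, 2 * η x = x * (x - 1) := fun x =>
    Int.mul_ediv_cancel' (Int.even_mul_pred_self x).two_dvd
  have : ∀ x y : ℤ, η (x + y) = η x + η y + x * y := fun x y => by
    have e : (x + y) * (x + y - 1) = x * (x - 1) + y * (y - 1) + 2 * (x * y) := by ring
    linarith [h x, h y, h (x + y)]
  exact ⟨η, rfl, this⟩

end HeisenbergVariant

open HeisenbergVariant in
theorem theorem1p1 (r : ℕ) (t : ℤ) (ht0 : t ≠ 0) (htr : t ∣ (r : ℤ)) :
    (∀ n : ℕ, 1 < n →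
      (0 < r →
        Nonempty (SchurMultiplier (HeisenbergVariant n (ZMod r) (t : ZMod r)) ≃+
          (Fin (2 * n ^ 2 - n - 1) → ZMod r) × (Fin (2 * n + 1) → ZMod t.natAbs))) ∧
      (r = 0 →
        Nonempty (SchurMultiplier (HeisenbergVariant n (ZMod r) (t : ZMod r)) ≃+
          (Fin (2 * n ^ 2 - n - 1) → Additive ℂˣ) × (Fin (2 * n) → ZMod t.natAbs)))) ∧
    (Odd r →
      Nonempty (SchurMultiplier (HeisenbergVariant 1 (ZMod r) (t : ZMod r)) ≃+
        (Fin 2 → ZMod r) × ZMod t.natAbs)) ∧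
    (r = 0 →
      Nonempty (SchurMultiplier (HeisenbergVariant 1 (ZMod r) (t : ZMod r)) ≃+
        (Fin 2 → Additive ℂˣ))) := by
  obtain ⟨eμ⟩ := Complex.nonempty_torsion_addEquiv_zmod (Int.natAbs_ne_zero.2 ht0)
  have hpos : 0 < r → Nonempty ((ZMod r →+ Additive ℂˣ) ≃+ ZMod r) := fun hr => by
    obtain ⟨e⟩ := ZMod.nonempty_addMonoidHom_addEquiv (Additive ℂˣ) r
    obtain ⟨e'⟩ := Complex.nonempty_torsion_addEquiv_zmod hr.ne'
    exact ⟨e.trans e'⟩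
  -- For r = 0 the cokernel of t is trivial, because ℂˣ is divisible and t ≠ 0.
  have hzero : ∀ m : ZMod 0 →+ Additive ℂˣ, (0 : (ZMod 0 →+ Additive ℂˣ) →+ PUnit.{1}) m = 0 ↔
      ∃ m' : ZMod 0 →+ Additive ℂˣ, ∀ x, m x = m' ((Int.cast t : ZMod 0) * x) := fun m => by
    refine iff_of_true rfl ?_
    obtain ⟨k, hk⟩ := Complex.additive_units_exists_zsmul_eq ht0 (m 1)
    obtain ⟨m', hm'⟩ := ZMod.exists_addMonoidHom_apply_one 0 (zero_nsmul k)
    have : m = t • m' := ZMod.addMonoidHom_ext_one (by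
      rw [← hk, ← hm']
      rfl)
    refine ⟨m', fun x => ?_⟩
    rw [ZMod.addMonoidHom_apply_intCast_mul, this]
    rfl
  have hsurj : Function.Surjective (0 : (ZMod 0 →+ Additive ℂˣ) →+ PUnit.{1}) := fun x => ⟨0, rfl⟩
  have eZ : (ZMod 0 →+ Additive ℂˣ) ≃+ Additive ℂˣ := (zmultiplesAddHom (Additive ℂˣ)).symm
  refine ⟨fun n hn => ⟨fun hr => ?_, fun hr => ?_⟩, fun hr => ?_, fun hr => ?_⟩
  · obtain ⟨eM⟩ := hpos hr
    obtain ⟨eT⟩ := nonempty_centralCharacters_addEquiv (Additive ℂˣ) hn htr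
    obtain ⟨κ, hκ, hκ0⟩ := ZMod.exists_cokernel_mul htr eM
    -- Central characters kill the correction when n > 1, so η = 0 will do.
    obtain ⟨e⟩ := nonempty_schurMultiplier_addEquiv_pi (by omega) ZMod.intCast_surjective
      (t : ZMod r) (η := 0) rfl (fun h => absurd h hn.ne') eM (eT.trans eμ) κ hκ hκ0
    let f : ZMod t.natAbs × (Fin (2 * n) → ZMod t.natAbs) ≃+ (Fin (2 * n + 1) → ZMod t.natAbs) :=
      { Fin.consEquiv (fun _ => ZMod t.natAbs) with
        map_add' := fun x y => by
          funext i
          refine Fin.cases rfl (fun _ => rfl) i }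
    exact ⟨e.trans ((AddEquiv.refl _).prodCongr f)⟩
  · subst hr
    obtain ⟨eT⟩ := nonempty_centralCharacters_addEquiv (Additive ℂˣ) hn htr
    obtain ⟨e⟩ := nonempty_schurMultiplier_addEquiv_pi (by omega) ZMod.intCast_surjective
      (Int.cast t : ZMod 0) (η := 0) rfl (fun h => absurd h hn.ne') eZ (eT.trans eμ) 0 hsurj hzero
    exact ⟨e.trans ((AddEquiv.refl _).prodCongr AddEquiv.uniqueProd)⟩
  · obtain ⟨η, hη0, hη⟩ := exists_quadratic_of_odd hr
    obtain ⟨eM⟩ := hpos hr.pos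
    obtain ⟨eT⟩ := nonempty_centralCharacters_one_addEquiv (K := Additive ℂˣ) (t : ZMod r)
    obtain ⟨κ, hκ, hκ0⟩ := ZMod.exists_cokernel_mul htr eM
    obtain ⟨e⟩ := nonempty_schurMultiplier_addEquiv_pi one_pos ZMod.intCast_surjective
      (t : ZMod r) hη0 (fun _ => hη) eM (eT.trans eM) κ hκ hκ0
    -- For n = 1 the exponent 2n² - n - 1 is 0, so the first factor is trivial; the two copies of
    -- `ZMod r` come from μ and ν.
    exact ⟨e.trans ((AddEquiv.uniqueProd (N := Fin 0 → ZMod r)).trans AddEquiv.prodComm)⟩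
  · subst hr
    obtain ⟨η, hη0, hη⟩ := exists_quadratic_int
    obtain ⟨eT⟩ := nonempty_centralCharacters_one_addEquiv (K := Additive ℂˣ) (Int.cast t : ZMod 0)
    obtain ⟨e⟩ := nonempty_schurMultiplier_addEquiv_pi one_pos ZMod.intCast_surjective
      (Int.cast t : ZMod 0) hη0 (fun _ => hη) eZ (eT.trans eZ) 0 hsurj hzero
    exact ⟨e.trans ((AddEquiv.uniqueProd (N := Fin 0 → Additive ℂˣ)).trans AddEquiv.uniqueProd)⟩
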